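/- Let $q>2$ be a prime power, let $n\ge 1$, let $k\ge 1$ be a divisor of $n$, and let $\mathbb F_q\subseteq\mathbb F_{q^k}\subseteq\mathbb F_{q^n}$. Let $\ell_\infty$ be the line $c=0$ of $\mathrm{PG}(2,q^n)$. Take $\mathbb F_{q^n}\times\mathbb F_{q^n}\times\mathbb F_q$ as the underlying $\mathbb F_q$-vector space of $\mathrm{PG}(2n,q)$, and let $H_\infty\simeq\mathrm{PG}(2n-1,q)$ be its hyperplane $c=0$. For each divisor $d$ of $n$ let $$\mathcal D_d=\bigl\{\{(ax,bx,0)_{\mathbb F_q} : x\in\mathbb F_{q^d}^*\} : a,b\in\mathbb F_{q^n},\ (a,b)\neq(0,0)\bigr\},$$ a Desarguesian $(d-1)$-spread of $H_\infty$, and put $\mathcal D=\mathcal D_n$. The André/Bruck–Bose map $\phi$ sends the point $(a,b,1)_{\mathbb F_{q^n}}$ to the point $(a,b,1)_{\mathbb F_q}$ and the point $(a,b,0)_{\mathbb F_{q^n}}$ of $\ell_\infty$ to the element $\{(ax,bx,0)_{\mathbb F_q}: x\in\mathbb F_{q^n}^*\}$ of $\mathcal D$. An $\mathbb F_{q^k}$-subline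 is a set $\{(su+tv)_{\mathbb F_{q^n}} : s,t\in\mathbb F_{q^k},\ (s,t)\ne(0,0)\}$ with $u,v\in\mathbb F_{q^n}^3$ linearly independent over $\mathbb F_{q^n}$. A regulus is a set of $q+1$ pairwise disjoint $(n-1)$-spaces contained in a $(2n-1)$-space such that every line meeting three of them meets all of them. All dimensions of subspaces below are projective. Then any three distinct elements of $\mathcal D$ lie in a unique regulus. Moreover, if $\mathcal S$ is a set of $q^k+1$ elements of $\mathcal D$, the following are equivalent: 1. $\mathcal S$ is the image under $\phi$ of an $\mathbb F_{q^k}$-subline contained in $\ell_\infty$; 2. for any three distinct elements of $\mathcal S$, the unique regulus through them is contained in $\mathcal S$; 3. there is a $(2k-1)$-dimensional subspace of $H_\infty$ that meets each element of $\mathcal S$ in a $(k-1)$-dimensional space; 4. there is a $(2k-1)$-dimensional subspace of $H_\infty$ that meets each element of $\mathcal S$ in an element of $\mathcal D_k$. -/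

import Mathlib

open scoped LinearAlgebra.Projectivization

/-!  Projective spaces are handled through their underlying vector spaces: a subspace of projective
dimension `d` is a linear subspace of (vector space) dimension `d + 1`, and two subspaces meet when
their linear intersection is nonzero.  `F` plays the role of the field with `q` elements and `K`
that of its extension of degree `n`. -/

namespace ABB

section Regulus

variable (F : Type*) [Field F] {V : Type*} [AddCommGroup V] [Module F V]

/-- A regulus of `(n - 1)`-spaces: a set of `q + 1` pairwise disjoint `(n - 1)`-spaces contained in
a `(2 n - 1)`-space, such that every line that meets three of them meets all of them. -/
structure IsRegulus (n : ℕ) (R : Set (Submodule F V)) : Prop where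
  ncard_eq : R.ncard = Nat.card F + 1
  finrank_eq : ∀ A ∈ R, Module.finrank F A = n
  pairwise_disjoint : ∀ A ∈ R, ∀ B ∈ R, A ≠ B → A ⊓ B = ⊥
  ambient : ∃ W : Submodule F V, Module.finrank F W = 2 * n ∧ ∀ A ∈ R, A ≤ W
  transversal : ∀ l : Submodule F V, Module.finrank F l = 2 →
    (∃ A ∈ R, ∃ B ∈ R, ∃ C ∈ R, A ≠ B ∧ A ≠ C ∧ B ≠ C ∧
      A ⊓ l ≠ ⊥ ∧ B ⊓ l ≠ ⊥ ∧ C ⊓ l ≠ ⊥) →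
    ∀ A ∈ R, A ⊓ l ≠ ⊥

/-- `R` is a regulus of `(n - 1)`-spaces having `A`, `B`, `C` among its elements. -/
def IsRegulusThrough (n : ℕ) (A B C : Submodule F V) (R : Set (Submodule F V)) : Prop :=
  IsRegulus F n R ∧ A ∈ R ∧ B ∈ R ∧ C ∈ R

end Regulus

variable (F K : Type*) [Field F] [Field K] [Algebra F K]

/-- The line at infinity of `PG(2, q^n)`, with equation `c = 0`. -/
def lineInfinity : Set (ℙ K (K × K × K)) :=
  {P | ∀ v ∈ P.submodule, v.2.2 = 0}

/-- The hyperplane `c = 0` of `PG(2 n, q)`, whose underlying vector space is `K × K × F`. -/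
def hyperplaneInfinity : Submodule F (K × K × F) where
  carrier := {v | v.2.2 = 0}
  add_mem' := by
    intro v w hv hw
    simp only [Set.mem_ofPred_eq] at hv hw ⊢
    simp [hv, hw]
  zero_mem' := rfl
  smul_mem' := by
    intro c v hv
    simp only [Set.mem_ofPred_eq] at hv ⊢
    simp [hv]

/-- The `F`-linear inclusion of `K × K × F` into `K × K × K`. -/
def inclusion : (K × K × F) →ₗ[F] (K × K × K) :=
  LinearMap.prodMap LinearMap.id (LinearMap.prodMap LinearMap.id (Algebra.linearMap F K))

variable {K}

/-- The ABB-map from points of `PG(2, q^n)` to subspaces of `PG(2 n, q)`: the point `P` goes to the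
space of all `(a, b, c)`, `c` in `F`, that lie in the `K`-line `P`.  Hence `(a, b, 1)` goes
to the point `(a, b, 1)` and `(a, b, 0)` goes to the `(n - 1)`-space of all `(a x, b x, 0)`; see
`abbMap_affine` and `abbMap_infinite`. -/
def abbMap (P : ℙ K (K × K × K)) : Submodule F (K × K × F) :=
  (P.submodule.restrictScalars F).comap (inclusion F K)

variable {F}

/-- The subspace `{(a x, b x, 0) | x ∈ E}` of `K × K × F`. -/
def spreadElement (E : IntermediateField F K) (a b : K) : Submodule F (K × K × F) where
  carrier := {v | ∃ x ∈ E, v = (a * x, b * x, 0)}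
  add_mem' := by
    rintro _ _ ⟨x, hx, rfl⟩ ⟨y, hy, rfl⟩
    exact ⟨x + y, E.add_mem hx hy, by simp [mul_add]⟩
  zero_mem' := ⟨0, E.zero_mem, by simp; rfl⟩
  smul_mem' := by
    rintro c _ ⟨x, hx, rfl⟩
    exact ⟨c • x, E.smul_mem hx, by simp⟩

/-- The Desarguesian spread `D_k` of the hyperplane at infinity, where `E` is the subfield of `K`
with `q^k` elements: all spaces `{(a x, b x, 0) | x ∈ E}` with `a`, `b` in `K`, not both zero. -/
def subspread (E : IntermediateField F K) : Set (Submodule F (K × K × F)) :=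
  {A | ∃ a b : K, (a, b) ≠ (0, 0) ∧ A = spreadElement E a b}

variable (F K) in
/-- The Desarguesian spread `D` of the hyperplane at infinity: all `(n - 1)`-spaces
`{(a x, b x, 0) | x ∈ K}` with `a`, `b` in `K`, not both zero. -/
def desarguesianSpread : Set (Submodule F (K × K × F)) :=
  subspread (⊤ : IntermediateField F K)

/-- An `E`-subline of `PG(2, q^n)`: the points of a line whose coordinates, with respect to a
suitable frame of that line, can be taken in `E`. -/
def IsSubline (E : IntermediateField F K) (m : Set (ℙ K (K × K × K))) : Prop :=
  ∃ u v : K × K × K, LinearIndependent K ![u, v] ∧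
    m = {P | ∃ s ∈ E, ∃ t ∈ E, ∃ h : s • u + t • v ≠ 0, P = Projectivization.mk K (s • u + t • v) h}

theorem abbMap_affine (a b : K) (h : ((a, b, 1) : K × K × K) ≠ 0) :
    abbMap F (Projectivization.mk K (a, b, 1) h) = Submodule.span F {(a, b, (1 : F))} := by
  ext ⟨x, y, c⟩
  simp only [abbMap, inclusion, Submodule.mem_comap, Submodule.restrictScalars_mem,
    Projectivization.submodule_mk, Submodule.mem_span_singleton, LinearMap.prodMap_apply,
    LinearMap.id_apply, Algebra.linearMap_apply, Prod.smul_mk, Prod.mk.injEq, smul_eq_mul, mul_one]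
  constructor
  · rintro ⟨r, rfl, rfl, rfl⟩
    exact ⟨c, by simp [Algebra.smul_def], by simp [Algebra.smul_def], rfl⟩
  · rintro ⟨r, rfl, rfl, rfl⟩
    exact ⟨algebraMap F K r, by simp [Algebra.smul_def], by simp [Algebra.smul_def], rfl⟩

theorem abbMap_infinite (a b : K) (h : ((a, b, 0) : K × K × K) ≠ 0) :
    abbMap F (Projectivization.mk K (a, b, 0) h) = spreadElement ⊤ a b := by
  ext ⟨x, y, c⟩
  simp only [abbMap, inclusion, Submodule.mem_comap, Submodule.restrictScalars_mem,
    Projectivization.submodule_mk, Submodule.mem_span_singleton, LinearMap.prodMap_apply,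
    LinearMap.id_apply, Algebra.linearMap_apply, Prod.smul_mk, Prod.mk.injEq, smul_eq_mul, mul_zero]
  constructor
  · rintro ⟨r, rfl, rfl, h0⟩
    have hc : c = 0 := (map_eq_zero (algebraMap F K)).1 h0.symm
    exact ⟨r, trivial, by simp [hc, mul_comm]⟩
  · rintro ⟨r, -, hr⟩
    simp only [Prod.mk.injEq] at hr
    obtain ⟨rfl, rfl, rfl⟩ := hr
    exact ⟨r, mul_comm _ _, mul_comm _ _, by simp⟩

end ABB

namespace ABB

/-! ### Spread elements as points of the projective line over `K` -/

variable {F K : Type*} [Field F] [Field K] [Algebra F K]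

/-! Elements of the spread are the points of `PG(1, K)`, and three distinct ones can be written as
those through `u`, `v`, `u + v`. The regulus through them is then the `F`-subline spanned by `u` and
`v` (`isRegulusThrough_iff`), so condition 2 says that `S` is closed under `F`-sublines. The
equivalences are proved in the cycle 1 → 4 → 3 → 2 → 1.

For 1 → 4, the `E`-span of `u` and `v` serves as the subspace. 4 → 3 is a dimension count. For 3 →
2, since `(q^k + 1)(q^k - 1) = q^(2k) - 1`, the traces of `S` partition the nonzero vectors of `W`;
an element of a regulus through three members of `S` meets `W`, hence shares a point with a member
of `S` and equals it.

For 2 → 1, let `T` be the set of `t` such that the element through `u + t v` is in `S`. Closure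
under reguli makes `T` closed under affine `F`-combinations, and `q > 2` makes it an `F`-subspace.
Exchanging `u` and `v` shows that the inverses of its nonzero elements also come from a subspace, so
by Hua's identity `T` is a subfield (`exists_intermediateField_of_inv`). Its size forces `T = E`. -/

variable (F K) in
/-- The inclusion of `K × K` into `K × K × F` as the hyperplane at infinity. -/
def inclInfinity : (K × K) →ₗ[F] (K × K × F) :=
  LinearMap.prodMap LinearMap.id (LinearMap.inl F K F)

theorem inclInfinity_apply (w : K × K) : inclInfinity F K w = (w.1, w.2, 0) := rfl

theorem inclInfinity_injective : Function.Injective (inclInfinity F K) := by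
  rintro ⟨a, b⟩ ⟨c, d⟩ h
  simpa [inclInfinity_apply] using h

theorem range_inclInfinity :
    LinearMap.range (inclInfinity F K) = hyperplaneInfinity F K := by
  ext ⟨a, b, c⟩
  constructor
  · rintro ⟨w, hw⟩
    rw [← hw]
    rfl
  · intro h
    have hc : c = 0 := h
    exact ⟨(a, b), by simp [inclInfinity_apply, hc]⟩

theorem mem_spreadElement {E : IntermediateField F K} {w : K × K} {p : K × K × F} :
    p ∈ spreadElement E w.1 w.2 ↔ ∃ x ∈ E, p = inclInfinity F K (x • w) := by
  change (∃ x ∈ E, p = (w.1 * x, w.2 * x, 0)) ↔ _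
  simp only [inclInfinity_apply, Prod.smul_fst, Prod.smul_snd, smul_eq_mul, mul_comm]

theorem finrank_spreadElement (E : IntermediateField F K) {w : K × K} (hw : w ≠ 0) :
    Module.finrank F (spreadElement E w.1 w.2) = Module.finrank F E := by
  let f : E →ₗ[F] (K × K × F) :=
    inclInfinity F K ∘ₗ ((LinearMap.toSpanSingleton K (K × K) w).restrictScalars F) ∘ₗ
      E.val.toLinearMap
  have hf : Function.Injective f :=
    inclInfinity_injective.comp ((smul_left_injective K hw).comp Subtype.val_injective)
  have hr : LinearMap.range f = spreadElement E w.1 w.2 := by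
    ext p
    rw [mem_spreadElement]
    constructor
    · rintro ⟨x, rfl⟩
      exact ⟨x, x.2, rfl⟩
    · rintro ⟨x, hx, rfl⟩
      exact ⟨⟨x, hx⟩, rfl⟩
  rw [← hr, LinearMap.finrank_range_of_inj hf]

variable (F) in
/-- The element of the Desarguesian spread that contains the vector `w`. -/
def spreadThrough (w : K × K) : Submodule F (K × K × F) :=
  spreadElement (⊤ : IntermediateField F K) w.1 w.2

theorem mem_spreadThrough {w : K × K} {p : K × K × F} :
    p ∈ spreadThrough F w ↔ ∃ x : K, p = inclInfinity F K (x • w) := by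
  simp [spreadThrough, mem_spreadElement]

theorem smul_mem_spreadThrough (x : K) (w : K × K) :
    inclInfinity F K (x • w) ∈ spreadThrough F w :=
  mem_spreadThrough.2 ⟨x, rfl⟩

theorem mem_desarguesianSpread {A : Submodule F (K × K × F)} :
    A ∈ desarguesianSpread F K ↔ ∃ w : K × K, w ≠ 0 ∧ A = spreadThrough F w :=
  ⟨fun ⟨a, b, h, hA⟩ => ⟨(a, b), h, hA⟩, fun ⟨w, h, hA⟩ => ⟨w.1, w.2, h, hA⟩⟩

theorem finrank_spreadThrough {w : K × K} (hw : w ≠ 0) :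
    Module.finrank F (spreadThrough F w) = Module.finrank F K := by
  rw [spreadThrough, finrank_spreadElement _ hw, IntermediateField.finrank_top']

theorem spreadThrough_smul {c : K} (hc : c ≠ 0) (w : K × K) :
    spreadThrough F (c • w) = spreadThrough F w := by
  ext p
  rw [mem_spreadThrough, mem_spreadThrough]
  constructor
  · rintro ⟨x, rfl⟩
    exact ⟨x * c, by rw [mul_smul]⟩
  · rintro ⟨x, rfl⟩
    exact ⟨x * c⁻¹, by rw [smul_smul, inv_mul_cancel_right₀ hc]⟩

theorem spreadThrough_eq_of_mem {w w' : K × K} {p : K × K × F} (hp : p ≠ 0)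
    (h : p ∈ spreadThrough F w) (h' : p ∈ spreadThrough F w') :
    spreadThrough F w = spreadThrough F w' := by
  obtain ⟨x, rfl⟩ := mem_spreadThrough.1 h
  obtain ⟨y, hy⟩ := mem_spreadThrough.1 h'
  have hxy := inclInfinity_injective hy
  have hx : x ≠ 0 := by rintro rfl; simp at hp
  have hy0 : y ≠ 0 := by rintro rfl; simp [hxy] at hp
  rw [← spreadThrough_smul hx, hxy, spreadThrough_smul hy0]

theorem spreadThrough_inf_eq_bot {w w' : K × K} (h : spreadThrough F w ≠ spreadThrough F w') :
    spreadThrough F w ⊓ spreadThrough F w' = ⊥ := by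
  by_contra hne
  obtain ⟨p, hp, hp0⟩ := Submodule.exists_mem_ne_zero_of_ne_bot hne
  exact h (spreadThrough_eq_of_mem hp0 hp.1 hp.2)

theorem linearIndependent_of_spreadThrough_ne {u v : K × K} (hu : u ≠ 0) (hv : v ≠ 0)
    (h : spreadThrough F u ≠ spreadThrough F v) : LinearIndependent K ![u, v] := by
  rw [LinearIndependent.pair_iff' hu]
  rintro a rfl
  have ha : a ≠ 0 := by rintro rfl; simp at hv
  exact h (spreadThrough_smul ha u).symm

theorem smul_add_smul_inj {u v : K × K} (h : LinearIndependent K ![u, v]) {a b c d : K}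
    (e : a • u + b • v = c • u + d • v) : a = c ∧ b = d := by
  have := LinearIndependent.pair_iff.1 h (a - c) (b - d) (by
    rw [sub_smul, sub_smul, sub_add_sub_comm, e, sub_self])
  exact ⟨sub_eq_zero.1 this.1, sub_eq_zero.1 this.2⟩

theorem smul_add_smul_ne_zero {u v : K × K} (h : LinearIndependent K ![u, v]) {a b : K}
    (hab : a ≠ 0 ∨ b ≠ 0) : a • u + b • v ≠ 0 := fun e => by
  have := LinearIndependent.pair_iff.1 h a b e
  tauto

theorem spreadThrough_eq_iff {u v : K × K} (h : LinearIndependent K ![u, v]) {a b c d : K}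
    (hab : a ≠ 0 ∨ b ≠ 0) :
    spreadThrough F (a • u + b • v) = spreadThrough F (c • u + d • v) ↔
      ∃ r : K, r ≠ 0 ∧ a = r * c ∧ b = r * d := by
  constructor
  · intro e
    have hm := smul_mem_spreadThrough (F := F) 1 (a • u + b • v)
    rw [e, one_smul] at hm
    obtain ⟨r, hr⟩ := mem_spreadThrough.1 hm
    have hr := inclInfinity_injective hr
    rw [smul_add, smul_smul, smul_smul] at hr
    obtain ⟨h1, h2⟩ := smul_add_smul_inj h hr
    refine ⟨r, ?_, h1, h2⟩
    rintro rfl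
    simp_all
  · rintro ⟨r, hr, rfl, rfl⟩
    rw [mul_smul, mul_smul, ← smul_add, spreadThrough_smul hr]

/-! ### Sublines of the spread and their frames -/

section Subline

variable {G : Type*} [Field G] [Algebra G K]

variable (F) in
/-- The elements of the Desarguesian spread that contain a nonzero vector of `P`. -/
def spreadMeeting (P : Submodule G (K × K)) : Set (Submodule F (K × K × F)) :=
  {A | ∃ w ∈ P, w ≠ 0 ∧ A = spreadThrough F w}

theorem mem_spreadMeeting_span {u v : K × K} (h : LinearIndependent K ![u, v])
    {A : Submodule F (K × K × F)} :
    A ∈ spreadMeeting F (Submodule.span G {u, v}) ↔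
      A = spreadThrough F v ∨ ∃ t : G, A = spreadThrough F (u + t • v) := by
  constructor
  · rintro ⟨w, hw, hw0, rfl⟩
    obtain ⟨s, t, rfl⟩ := Submodule.mem_span_pair.1 hw
    by_cases hs : s = 0
    · subst hs
      have ht : t ≠ 0 := by rintro rfl; simp at hw0
      left
      rw [zero_smul, zero_add, ← algebraMap_smul K t v,
        spreadThrough_smul (by simpa using ht)]
    · right
      refine ⟨s⁻¹ * t, ?_⟩
      rw [← spreadThrough_smul (c := algebraMap G K s) (by simpa using hs) (u + _),
        algebraMap_smul, smul_add, smul_smul, mul_inv_cancel_left₀ hs]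
  · rintro (rfl | ⟨t, rfl⟩)
    · exact ⟨v, Submodule.subset_span (by simp), h.ne_zero 1, rfl⟩
    · refine ⟨u + t • v, Submodule.mem_span_pair.2 ⟨1, t, by simp⟩, ?_, rfl⟩
      have := smul_add_smul_ne_zero h (a := 1) (b := algebraMap G K t) (by simp)
      simpa using this

theorem spreadThrough_add_smul_inj {u v : K × K} (h : LinearIndependent K ![u, v]) {s t : K}
    (e : spreadThrough F (u + s • v) = spreadThrough F (u + t • v)) : s = t := by
  have := (spreadThrough_eq_iff (F := F) h (a := 1) (b := s) (c := 1) (d := t) (by simp)).1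
    (by simpa using e)
  obtain ⟨r, -, h1, h2⟩ := this
  rw [h2, ← mul_one r, ← h1, one_mul]

theorem spreadThrough_add_smul_ne {u v : K × K} (h : LinearIndependent K ![u, v]) (t : K) :
    spreadThrough F (u + t • v) ≠ spreadThrough F v := by
  intro e
  have := (spreadThrough_eq_iff (F := F) h (a := 1) (b := t) (c := 0) (d := 1) (by simp)).1
    (by simpa using e)
  obtain ⟨r, -, h1, h2⟩ := this
  simp_all

theorem ncard_spreadMeeting_span [Finite G] {u v : K × K} (h : LinearIndependent K ![u, v]) :
    (spreadMeeting F (Submodule.span G {u, v})).ncard = Nat.card G + 1 := by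
  have e : spreadMeeting F (Submodule.span G {u, v}) =
      insert (spreadThrough F v) (Set.range fun t : G => spreadThrough F (u + t • v)) := by
    ext A
    rw [mem_spreadMeeting_span h, Set.mem_insert_iff, Set.mem_range]
    simp only [eq_comm]
  rw [e, Set.ncard_insert_of_notMem, ← Set.image_univ, Set.ncard_image_of_injective,
    Set.ncard_univ]
  · intro s t hst
    simp only [← algebraMap_smul K (_ : G) v] at hst
    exact (algebraMap G K).injective (spreadThrough_add_smul_inj h hst)
  · rintro ⟨t, ht⟩
    simp only [← algebraMap_smul K (_ : G) v] at ht
    exact spreadThrough_add_smul_ne h _ ht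

theorem finrank_span_pair {u v : K × K} (h : LinearIndependent K ![u, v]) :
    Module.finrank G (Submodule.span G {u, v}) = 2 := by
  have hli : LinearIndependent G ![u, v] :=
    h.restrict_scalars (by
      intro r s hrs
      simpa [Algebra.smul_def] using hrs)
  have := finrank_span_eq_card hli
  rwa [Matrix.range_cons_cons_empty, Fintype.card_fin] at this

/-- Three distinct spread elements through vectors of a `G`-form `P` of `K × K` can be moved
to standard position by the choice of a `G`-basis of `P`. -/
theorem exists_frame {P : Submodule G (K × K)} (hP : Module.finrank G P = 2)
    {A B C : Submodule F (K × K × F)} (hA : A ∈ spreadMeeting F P) (hB : B ∈ spreadMeeting F P)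
    (hC : C ∈ spreadMeeting F P) (hAB : A ≠ B) (hAC : A ≠ C) (hBC : B ≠ C) :
    ∃ u v : K × K, LinearIndependent K ![u, v] ∧ P = Submodule.span G {u, v} ∧
      A = spreadThrough F u ∧ B = spreadThrough F v ∧ C = spreadThrough F (u + v) := by
  obtain ⟨a, ha, ha0, rfl⟩ := hA
  obtain ⟨b, hb, hb0, rfl⟩ := hB
  obtain ⟨c, hc, hc0, rfl⟩ := hC
  have hfin : FiniteDimensional G P := .of_finrank_pos (by omega)
  have key : ∀ x y : K × K, LinearIndependent K ![x, y] → x ∈ P → y ∈ P →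
      P = Submodule.span G {x, y} := by
    intro x y hxy hx hy
    refine (Submodule.eq_of_le_of_finrank_eq ?_ ?_).symm
    · rw [Submodule.span_le]
      rintro z (rfl | rfl) <;> assumption
    · rw [hP, finrank_span_pair hxy]
  have hab := linearIndependent_of_spreadThrough_ne ha0 hb0 hAB
  rw [key a b hab ha hb] at hc
  obtain ⟨s, t, rfl⟩ := Submodule.mem_span_pair.1 hc
  have hs : algebraMap G K s ≠ 0 := by
    intro hs
    have hs : s = 0 := by simpa using hs
    subst hs
    have ht : algebraMap G K t ≠ 0 := by
      intro ht
      have ht : t = 0 := by simpa using ht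
      simp [ht] at hc0
    apply hBC
    rw [zero_smul, zero_add, ← algebraMap_smul K t b, spreadThrough_smul ht]
  have ht : algebraMap G K t ≠ 0 := by
    intro ht
    have ht : t = 0 := by simpa using ht
    subst ht
    apply hAC
    rw [zero_smul, add_zero, ← algebraMap_smul K s a, spreadThrough_smul hs]
  have h1 : spreadThrough F a = spreadThrough F (s • a) := by
    rw [← algebraMap_smul K s a, spreadThrough_smul hs]
  have h2 : spreadThrough F b = spreadThrough F (t • b) := by
    rw [← algebraMap_smul K t b, spreadThrough_smul ht]
  -- Rescaling by elements of `G` keeps the vectors in `P` and in the same spread elements, and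
  -- makes the third vector their sum.
  have hli : LinearIndependent K ![s • a, t • b] := by
    refine linearIndependent_of_spreadThrough_ne (F := F) ?_ ?_ ?_
    · rw [← algebraMap_smul K s a]
      exact smul_ne_zero hs ha0
    · rw [← algebraMap_smul K t b]
      exact smul_ne_zero ht hb0
    · rwa [← h1, ← h2]
  exact ⟨s • a, t • b, hli, key _ _ hli (P.smul_mem _ ha) (P.smul_mem _ hb), h1, h2, rfl⟩

end Subline

theorem exists_frame_spread {A B C : Submodule F (K × K × F)}
    (hA : A ∈ desarguesianSpread F K) (hB : B ∈ desarguesianSpread F K)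
    (hC : C ∈ desarguesianSpread F K) (hAB : A ≠ B) (hAC : A ≠ C) (hBC : B ≠ C) :
    ∃ u v : K × K, LinearIndependent K ![u, v] ∧
      A = spreadThrough F u ∧ B = spreadThrough F v ∧ C = spreadThrough F (u + v) := by
  have key : ∀ A ∈ desarguesianSpread F K, A ∈ spreadMeeting F (⊤ : Submodule K (K × K)) := by
    intro A hA
    obtain ⟨w, hw, rfl⟩ := mem_desarguesianSpread.1 hA
    exact ⟨w, trivial, hw, rfl⟩
  -- The whole spread is the `K`-subline attached to `P = ⊤`.
  obtain ⟨u, v, h, -, h'⟩ := exists_frame (G := K) (by simp) (key A hA) (key B hB) (key C hC)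
    hAB hAC hBC
  exact ⟨u, v, h, h'⟩

end ABB
namespace ABB

/-! ### The regulus through three spread elements -/

variable {F K : Type*} [Field F] [Field K] [Algebra F K]

/-- By dimension, `M` is the direct sum of its traces on the elements through `u` and `v`. A vector
`z (u + v)` of `M` splits accordingly, and uniqueness of coordinates makes its components `z u` and
`z v`. -/
theorem exists_smul_mem {u v : K × K} (h : LinearIndependent K ![u, v])
    {M : Submodule F (K × K × F)} [FiniteDimensional F M]
    (hM : Module.finrank F M ≤ Module.finrank F (spreadThrough F u ⊓ M : Submodule F (K × K × F)) +
      Module.finrank F (spreadThrough F v ⊓ M : Submodule F (K × K × F)))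
    (huv : spreadThrough F (u + v) ⊓ M ≠ ⊥) :
    ∃ z : K, z ≠ 0 ∧ inclInfinity F K (z • u) ∈ M ∧ inclInfinity F K (z • v) ∈ M := by
  have hne : spreadThrough F u ≠ spreadThrough F v := by
    simpa using spreadThrough_add_smul_ne (F := F) h 0
  have hsup : (spreadThrough F u ⊓ M) ⊔ (spreadThrough F v ⊓ M) = M := by
    have h1 : FiniteDimensional F (spreadThrough F u ⊓ M : Submodule F (K × K × F)) :=
      Submodule.finiteDimensional_inf_right _ _
    have h2 : FiniteDimensional F (spreadThrough F v ⊓ M : Submodule F (K × K × F)) :=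
      Submodule.finiteDimensional_inf_right _ _
    apply Submodule.eq_of_le_of_finrank_le (sup_le inf_le_right inf_le_right)
    have := Submodule.finrank_sup_add_finrank_inf_eq (spreadThrough F u ⊓ M)
      (spreadThrough F v ⊓ M)
    rw [← inf_inf_distrib_right, spreadThrough_inf_eq_bot hne, bot_inf_eq, finrank_bot,
      add_zero] at this
    rwa [this]
  obtain ⟨p, ⟨hp, hpM⟩, hp0⟩ := Submodule.exists_mem_ne_zero_of_ne_bot huv
  obtain ⟨z, rfl⟩ := mem_spreadThrough.1 hp
  rw [SetLike.mem_coe, ← hsup] at hpM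
  obtain ⟨a, ⟨ha, haM⟩, b, ⟨hb, hbM⟩, hab⟩ := Submodule.mem_sup.1 hpM
  obtain ⟨x, rfl⟩ := mem_spreadThrough.1 ha
  obtain ⟨y, rfl⟩ := mem_spreadThrough.1 hb
  rw [← map_add] at hab
  have hab := inclInfinity_injective hab
  rw [smul_add] at hab
  obtain ⟨hx, hy⟩ := smul_add_smul_inj h hab
  rw [hx] at haM
  rw [hy] at hbM
  refine ⟨z, ?_, haM, hbM⟩
  rintro rfl
  simp at hp0

/-- A subspace which is spanned by its traces on two elements of a regulus of the Desarguesian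
spread and meets a third one meets all of them. -/
theorem meets_of_meets_frame {u v : K × K} (h : LinearIndependent K ![u, v])
    {M : Submodule F (K × K × F)} [FiniteDimensional F M]
    (hM : Module.finrank F M ≤ Module.finrank F (spreadThrough F u ⊓ M : Submodule F (K × K × F)) +
      Module.finrank F (spreadThrough F v ⊓ M : Submodule F (K × K × F)))
    (huv : spreadThrough F (u + v) ⊓ M ≠ ⊥)
    {A : Submodule F (K × K × F)} (hA : A ∈ spreadMeeting F (Submodule.span F {u, v})) :
    A ⊓ M ≠ ⊥ := by
  obtain ⟨z, hz, hu, hv⟩ := exists_smul_mem h hM huv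
  obtain ⟨w, hw, hw0, rfl⟩ := hA
  obtain ⟨s, t, rfl⟩ := Submodule.mem_span_pair.1 hw
  refine Submodule.ne_bot_iff _ |>.2 ⟨_, ⟨smul_mem_spreadThrough z _, ?_⟩, ?_⟩
  · have e : z • (s • u + t • v) = s • z • u + t • z • v := by
      rw [smul_add, smul_comm z s, smul_comm z t]
    rw [e, map_add, LinearMap.map_smul, LinearMap.map_smul]
    exact M.add_mem (M.smul_mem _ hu) (M.smul_mem _ hv)
  · rw [Ne, map_eq_zero_iff _ inclInfinity_injective]
    exact smul_ne_zero hz hw0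

section Finite

variable [Finite K]

/-- Any three elements of an `F`-subline frame it, and a line meeting two disjoint spaces is spanned
by its traces on them; the transversal property is thus a case of `meets_of_meets_frame`. -/
theorem isRegulus_spreadMeeting [Finite F] {u v : K × K} (h : LinearIndependent K ![u, v]) :
    IsRegulus F (Module.finrank F K) (spreadMeeting F (Submodule.span F {u, v})) where
  ncard_eq := ncard_spreadMeeting_span h
  finrank_eq := by
    rintro _ ⟨w, -, hw, rfl⟩
    exact finrank_spreadThrough hw
  pairwise_disjoint := by
    rintro _ ⟨w, -, hw, rfl⟩ _ ⟨w', -, hw', rfl⟩ hne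
    exact spreadThrough_inf_eq_bot hne
  ambient := by
    refine ⟨LinearMap.range (inclInfinity F K), ?_, ?_⟩
    · rw [LinearMap.finrank_range_of_inj inclInfinity_injective, Module.finrank_prod, two_mul]
    · rintro _ ⟨w, -, hw, rfl⟩ p hp
      obtain ⟨x, rfl⟩ := mem_spreadThrough.1 hp
      exact ⟨_, rfl⟩
  transversal := by
    rintro l hl ⟨A, hA, B, hB, C, hC, hAB, hAC, hBC, hAl, hBl, hCl⟩ D hD
    obtain ⟨u', v', h', e, rfl, rfl, rfl⟩ :=
      exists_frame (finrank_span_pair h) hA hB hC hAB hAC hBC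
    rw [e] at hD
    refine meets_of_meets_frame h' ?_ hCl hD
    have := Submodule.one_le_finrank_iff.2 hAl
    have := Submodule.one_le_finrank_iff.2 hBl
    omega

/-- An element `D` disjoint from the one through `v` is described by vectors `x u + c(x) x v` with
`c(x)` in `F`, because the transversal lines through `x u` and `x v` meet it. Additivity of `D`
forces `c` to be essentially constant, which places `D` in the `F`-subline. -/
theorem IsRegulus.subset_spreadMeeting {u v : K × K} (h : LinearIndependent K ![u, v])
    {R : Set (Submodule F (K × K × F))} (hR : IsRegulus F (Module.finrank F K) R)
    (hu : spreadThrough F u ∈ R) (hv : spreadThrough F v ∈ R)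
    (huv : spreadThrough F (u + v) ∈ R) :
    R ⊆ spreadMeeting F (Submodule.span F {u, v}) := by
  intro D hD
  rw [mem_spreadMeeting_span h]
  by_cases hDv : D = spreadThrough F v
  · exact Or.inl hDv
  right
  have hdis := hR.pairwise_disjoint D hD _ hv hDv
  have hzero : ∀ y : K, inclInfinity F K (y • v) ∈ D → y = 0 := by
    intro y hy
    have : inclInfinity F K (y • v) ∈ (⊥ : Submodule F (K × K × F)) := by
      rw [← hdis]
      exact ⟨hy, smul_mem_spreadThrough y v⟩
    rw [Submodule.mem_bot, map_eq_zero_iff _ inclInfinity_injective] at this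
    exact (smul_eq_zero.1 this).resolve_right (h.ne_zero 1)
  -- The line joining `x u` and `x v` also contains `x (u + v)`, so it meets three elements of `R`
  -- and therefore `D`. The coefficient of `x u` at the common point is nonzero by `hzero` and can
  -- be scaled to 1.
  have hex : ∀ x : K, ∃ c : F, inclInfinity F K (x • u + (c • x) • v) ∈ D := by
    intro x
    by_cases hx : x = 0
    · exact ⟨0, by simp [hx]⟩
    have hli : LinearIndependent F ![inclInfinity F K (x • u), inclInfinity F K (x • v)] := by
      rw [LinearIndependent.pair_iff]
      intro s t hst
      rw [← map_smul, ← map_smul, ← map_add, map_eq_zero_iff _ inclInfinity_injective,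
        ← smul_assoc, ← smul_assoc] at hst
      have := LinearIndependent.pair_iff.1 h _ _ hst
      exact ⟨(smul_eq_zero.1 this.1).resolve_right hx, (smul_eq_zero.1 this.2).resolve_right hx⟩
    have hfr : Module.finrank F
        (Submodule.span F {inclInfinity F K (x • u), inclInfinity F K (x • v)}) = 2 := by
      have := finrank_span_eq_card hli
      rwa [Matrix.range_cons_cons_empty, Fintype.card_fin] at this
    have hne : ∀ w : K × K, w ≠ 0 →
        inclInfinity F K (x • w) ∈
          Submodule.span F {inclInfinity F K (x • u), inclInfinity F K (x • v)} →
        spreadThrough F w ⊓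
          Submodule.span F {inclInfinity F K (x • u), inclInfinity F K (x • v)} ≠ ⊥ := by
      intro w hw hm
      refine (Submodule.ne_bot_iff _).2 ⟨_, ⟨smul_mem_spreadThrough x w, hm⟩, ?_⟩
      rw [Ne, map_eq_zero_iff _ inclInfinity_injective]
      exact smul_ne_zero hx hw
    have hmu : inclInfinity F K (x • u) ∈
        Submodule.span F {inclInfinity F K (x • u), inclInfinity F K (x • v)} :=
      Submodule.subset_span (by simp)
    have hmv : inclInfinity F K (x • v) ∈
        Submodule.span F {inclInfinity F K (x • u), inclInfinity F K (x • v)} :=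
      Submodule.subset_span (by simp)
    have hAB : spreadThrough F u ≠ spreadThrough F v := by
      simpa using spreadThrough_add_smul_ne (F := F) h 0
    have hBC : spreadThrough F v ≠ spreadThrough F (u + v) := by
      simpa using (spreadThrough_add_smul_ne (F := F) h 1).symm
    have hAC : spreadThrough F u ≠ spreadThrough F (u + v) := by
      intro e
      have := spreadThrough_add_smul_inj (F := F) h (s := 0) (t := 1) (by simpa using e)
      simp at this
    have hD' := hR.transversal _ hfr ⟨_, hu, _, hv, _, huv, hAB, hAC, hBC,
      hne u (h.ne_zero 0) hmu, hne v (h.ne_zero 1) hmv,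
      hne (u + v) (by simpa using smul_add_smul_ne_zero h (a := 1) (b := 1) (by simp)) (by
        rw [smul_add, map_add]
        exact Submodule.add_mem _ hmu hmv)⟩ D hD
    obtain ⟨p, ⟨hpD, hpl⟩, hp0⟩ := Submodule.exists_mem_ne_zero_of_ne_bot hD'
    obtain ⟨s, t, rfl⟩ := Submodule.mem_span_pair.1 hpl
    have hs : s ≠ 0 := by
      rintro rfl
      rw [zero_smul, zero_add, ← map_smul, ← smul_assoc] at hpD hp0
      rw [hzero _ hpD] at hp0
      simp at hp0
    refine ⟨s⁻¹ * t, ?_⟩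
    have := D.smul_mem s⁻¹ hpD
    rwa [smul_add, inv_smul_smul₀ hs, smul_smul, ← map_smul, ← map_add, ← smul_assoc] at this
  have huniq : ∀ x y z : K, inclInfinity F K (x • u + y • v) ∈ D →
      inclInfinity F K (x • u + z • v) ∈ D → y = z := by
    intro x y z hy hz
    have := D.sub_mem hy hz
    rw [← map_sub, add_sub_add_left_eq_sub, ← sub_smul] at this
    exact sub_eq_zero.1 (hzero _ this)
  choose c hc using hex
  have hconst : ∀ x : K, c x • x = c 1 • x := by
    intro x
    have h1 : c (x + 1) • (x + 1) = c x • x + c 1 • 1 := by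
      refine huniq (x + 1) _ _ (hc _) ?_
      have := D.add_mem (hc x) (hc 1)
      rwa [← map_add, add_add_add_comm, ← add_smul, ← add_smul] at this
    -- If the scalars agree, additivity gives `c x = c 1`. Otherwise the additivity relation puts
    -- `x` in the prime line `F · 1`, where scaling the vector of `D` at `1` suffices.
    by_cases he : c (x + 1) = c x
    · rw [he, smul_add, add_right_inj] at h1
      have : c x = c 1 := smul_left_injective F (one_ne_zero (α := K)) h1
      rw [this]
    · have h2 : (c (x + 1) - c x) • x = (c 1 - c (x + 1)) • (1 : K) := by
        rw [sub_smul, sub_smul, sub_eq_sub_iff_add_eq_add, ← smul_add, h1, add_comm]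
      have h3 : x = ((c (x + 1) - c x)⁻¹ * (c 1 - c (x + 1))) • (1 : K) := by
        rw [mul_smul, ← h2, inv_smul_smul₀ (sub_ne_zero.2 he)]
      generalize (c (x + 1) - c x)⁻¹ * (c 1 - c (x + 1)) = d at h3
      refine huniq x _ _ (hc x) ?_
      have := D.smul_mem d (hc 1)
      rwa [← map_smul, smul_add, ← smul_assoc, ← smul_assoc, smul_comm d (c 1), ← h3] at this
  refine ⟨c 1, (Submodule.eq_of_le_of_finrank_eq ?_ ?_).symm⟩
  · intro p hp
    obtain ⟨x, rfl⟩ := mem_spreadThrough.1 hp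
    have := hc x
    rwa [hconst, smul_assoc, ← smul_comm x (c 1), ← smul_add] at this
  · rw [hR.finrank_eq D hD, finrank_spreadThrough]
    have := smul_add_smul_ne_zero h (a := 1) (b := algebraMap F K (c 1)) (by simp)
    simpa using this

theorem isRegulusThrough_iff [Finite F] {u v : K × K} (h : LinearIndependent K ![u, v])
    {R : Set (Submodule F (K × K × F))} :
    IsRegulusThrough F (Module.finrank F K) (spreadThrough F u) (spreadThrough F v)
      (spreadThrough F (u + v)) R ↔ R = spreadMeeting F (Submodule.span F {u, v}) := by
  constructor
  · rintro ⟨hR, hu, hv, huv⟩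
    refine Set.eq_of_subset_of_ncard_le (hR.subset_spreadMeeting h hu hv huv) ?_ (Set.toFinite _)
    rw [hR.ncard_eq, ncard_spreadMeeting_span h]
  · rintro rfl
    refine ⟨isRegulus_spreadMeeting h, ?_, ?_, ?_⟩ <;> rw [mem_spreadMeeting_span h]
    · exact Or.inr ⟨0, by simp⟩
    · exact Or.inl rfl
    · exact Or.inr ⟨1, by simp⟩

end Finite

end ABB
namespace ABB

/-! ### Hua's identity and subfields of a finite field -/

section Hua

variable {F K : Type*} [Field F] [Field K] [Algebra F K]

/-- This is Hua's identity `a - (a⁻¹ + (b⁻¹ - a)⁻¹)⁻¹ = a² b`: the left side uses only differences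
in `T`, sums in `T'` and passage between them by inversion. The cases where an inverse degenerates
are immediate. -/
theorem sq_mul_mem_of_inv {T T' : Submodule F K}
    (hT : ∀ x : K, x ≠ 0 → (x ∈ T ↔ x⁻¹ ∈ T')) {a b : K} (ha : a ∈ T) (hb : b ∈ T') :
    a ^ 2 * b ∈ T := by
  by_cases ha0 : a = 0
  · simp [ha0]
  by_cases hb0 : b = 0
  · simp [hb0]
  by_cases hab : b⁻¹ - a = 0
  · have : a ^ 2 * b = a := by
      rw [← sub_eq_zero.1 hab]
      field_simp
    rwa [this]
  have hb' : b⁻¹ ∈ T := (hT _ (inv_ne_zero hb0)).2 (by rwa [inv_inv])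
  have h1 : a⁻¹ + (b⁻¹ - a)⁻¹ ∈ T' :=
    T'.add_mem ((hT _ ha0).1 ha) ((hT _ hab).1 (T.sub_mem hb' ha))
  have e : a⁻¹ + (b⁻¹ - a)⁻¹ = (a - a ^ 2 * b)⁻¹ := by
    have h2 : a - a ^ 2 * b = a * b * (b⁻¹ - a) := by field_simp
    rw [h2]
    field_simp
    have h3 : 1 - a * b ≠ 0 := by
      intro h
      apply hab
      field_simp
      rw [mul_comm, h, mul_zero]
    field_simp
    ring
  have hne : a - a ^ 2 * b ≠ 0 := by
    have h2 : a - a ^ 2 * b = a * b * (b⁻¹ - a) := by field_simp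
    rw [h2]
    exact mul_ne_zero (mul_ne_zero ha0 hb0) hab
  rw [e] at h1
  have := T.sub_mem ha ((hT _ hne).2 h1)
  rwa [sub_sub_cancel] at this

/-- A form of Hua's theorem: a subspace of a finite field that contains `1` and whose nonzero
elements are the inverses of those of another subspace is a subfield. -/
theorem exists_intermediateField_of_inv [Finite K] {T T' : Submodule F K} (h1 : (1 : K) ∈ T)
    (hT : ∀ x : K, x ≠ 0 → (x ∈ T ↔ x⁻¹ ∈ T')) :
    ∃ E : IntermediateField F K, ∀ x, x ∈ E ↔ x ∈ T := by
  have hT' : ∀ x, x ∈ T' → x ∈ T := by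
    intro x hx
    simpa using sq_mul_mem_of_inv hT h1 hx
  have hinv : ∀ x ∈ T, x⁻¹ ∈ T := by
    intro x hx
    by_cases hx0 : x = 0
    · simp [hx0]
    · exact hT' _ ((hT x hx0).1 hx)
  have hsq : ∀ a ∈ T, ∀ c ∈ T, a ^ 2 * c ∈ T := by
    intro a ha c hc
    by_cases hc0 : c = 0
    · simp [hc0]
    · refine sq_mul_mem_of_inv hT ha ?_
      have := (hT _ (inv_ne_zero hc0)).1 (hinv c hc)
      rwa [inv_inv] at this
  have hmul : ∀ a ∈ T, ∀ c ∈ T, a * c ∈ T := by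
    intro a ha c hc
    -- In characteristic 2, squaring is injective on the finite set `T`, so `a` is the square of an
    -- element of `T`. Otherwise `a² c ∈ T` is polarised with `a + 1` and divided by 2.
    by_cases h2 : (2 : F) = 0
    · have h2K : (2 : K) = 0 := by
        rw [← map_ofNat (algebraMap F K) 2, h2, map_zero]
      have hinj : Function.Injective
          (fun x : T => (⟨(x : K) ^ 2, by simpa using hsq x x.2 1 h1⟩ : T)) := by
        intro x y hxy
        have hxy : (x : K) ^ 2 = (y : K) ^ 2 := congrArg Subtype.val hxy
        have : ((x : K) - y) ^ 2 = 0 := by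
          linear_combination hxy + ((y : K) ^ 2 - x * y) * h2K
        exact Subtype.ext (sub_eq_zero.1 (pow_eq_zero_iff two_ne_zero |>.1 this))
      obtain ⟨y, hy⟩ := Finite.injective_iff_surjective.1 hinj ⟨a, ha⟩
      have hy : (y : K) ^ 2 = a := congrArg Subtype.val hy
      rw [← hy]
      exact hsq _ y.2 c hc
    · have h3 : (2 : K) * (a * c) ∈ T := by
        have := T.sub_mem (T.sub_mem (hsq _ (T.add_mem ha h1) c hc) (hsq a ha c hc)) hc
        have e : (a + 1) ^ 2 * c - a ^ 2 * c - c = 2 * (a * c) := by ring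
        rwa [e] at this
      have := T.smul_mem (2 : F)⁻¹ h3
      have e : (2 : K) * (a * c) = (2 : F) • (a * c) := by
        rw [Algebra.smul_def, map_ofNat]
      rwa [e, inv_smul_smul₀ h2] at this
  refine ⟨{ carrier := T
            mul_mem' := fun {a b} ha hb => hmul a ha b hb
            one_mem' := h1
            add_mem' := fun ha hb => T.add_mem ha hb
            zero_mem' := T.zero_mem
            algebraMap_mem' := fun r => ?_
            inv_mem' := hinv }, fun x => Iff.rfl⟩
  rw [Algebra.algebraMap_eq_smul_one]
  exact T.smul_mem r h1

/-- Both fields have the same cardinality `N`, so each is the full set of solutions of `x ^ N = x`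
in `K`, which number at most `N`. -/
theorem intermediateField_eq_of_finrank_eq [Finite F] [Finite K] {E E' : IntermediateField F K}
    (h : Module.finrank F E = Module.finrank F E') : E = E' := by
  have key : ∀ L : IntermediateField F K, Module.finrank F L = Module.finrank F E →
      (L : Set K) = {x : K | x ^ (Nat.card E) = x} := by
    intro L hL
    have hcard : Nat.card L = Nat.card E := by
      rw [Module.natCard_eq_pow_finrank (K := F) (V := L), hL,
        ← Module.natCard_eq_pow_finrank (K := F) (V := E)]
    refine Set.eq_of_subset_of_ncard_le ?_ ?_ (Set.toFinite _)
    · intro x hx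
      have hfL : Fintype L := Fintype.ofFinite L
      have := FiniteField.pow_card (⟨x, hx⟩ : L)
      rw [← Nat.card_eq_fintype_card, hcard] at this
      simpa using congrArg Subtype.val this
    · have hE : 1 < Nat.card E := Finite.one_lt_card
      have hp := FiniteField.X_pow_card_sub_X_ne_zero K hE
      have hs : {x : K | x ^ (Nat.card E) = x} ⊆
          (Polynomial.X ^ Nat.card E - Polynomial.X : Polynomial K).rootSet K := by
        intro x hx
        rw [Polynomial.mem_rootSet]
        refine ⟨hp, ?_⟩
        have hx : x ^ (Nat.card E) = x := hx
        simp [hx]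
      refine (Set.ncard_le_ncard hs (Set.toFinite _)).trans ?_
      refine (Polynomial.ncard_rootSet_le _ _).trans ?_
      rw [FiniteField.X_pow_card_sub_X_natDegree_eq K hE, ← hcard]
      exact le_rfl
  exact SetLike.coe_injective ((key E rfl).trans (key E' h.symm).symm)

end Hua

/-! ### Sublines at infinity and the subspaces they span -/

variable {F K : Type*} [Field F] [Field K] [Algebra F K]

theorem exists_isSubline_iff (E : IntermediateField F K) (S : Set (Submodule F (K × K × F))) :
    (∃ m : Set (ℙ K (K × K × K)), IsSubline E m ∧ m ⊆ lineInfinity K ∧ abbMap F '' m = S) ↔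
      ∃ u v : K × K, LinearIndependent K ![u, v] ∧
        S = spreadMeeting F (Submodule.span E {u, v}) := by
  have himage : ∀ u v : K × K,
      abbMap F '' {P | ∃ s ∈ E, ∃ t ∈ E,
        ∃ h : s • ((u.1, u.2, 0) : K × K × K) + t • ((v.1, v.2, 0) : K × K × K) ≠ 0,
          P = Projectivization.mk K _ h} = spreadMeeting F (Submodule.span E {u, v}) := by
    intro u v
    have hsum : ∀ s t : K, s • ((u.1, u.2, 0) : K × K × K) + t • ((v.1, v.2, 0) : K × K × K) =
        ((s • u + t • v).1, (s • u + t • v).2, 0) := by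
      intro s t
      simp
    have hab : ∀ (s t : K)
        (h : s • ((u.1, u.2, 0) : K × K × K) + t • ((v.1, v.2, 0) : K × K × K) ≠ 0),
        abbMap F (Projectivization.mk K _ h) = spreadThrough F (s • u + t • v) := by
      intro s t h
      simp only [hsum]
      exact abbMap_infinite _ _ _
    ext A
    constructor
    · rintro ⟨_, ⟨s, hs, t, ht, h, rfl⟩, rfl⟩
      refine ⟨s • u + t • v, Submodule.mem_span_pair.2 ⟨⟨s, hs⟩, ⟨t, ht⟩, rfl⟩, ?_, hab s t h⟩
      intro e
      rw [hsum, e] at h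
      exact h rfl
    · rintro ⟨w, hw, hw0, rfl⟩
      obtain ⟨s, t, rfl⟩ := Submodule.mem_span_pair.1 hw
      have h : (s : K) • ((u.1, u.2, 0) : K × K × K) + (t : K) • ((v.1, v.2, 0) : K × K × K) ≠ 0 := by
        rw [hsum]
        intro e
        apply hw0
        rw [Prod.mk_eq_zero, Prod.mk_eq_zero] at e
        exact Prod.ext e.1 e.2.1
      exact ⟨_, ⟨s, s.2, t, t.2, h, rfl⟩, hab s t h⟩
  constructor
  · rintro ⟨_, ⟨u, v, huv, rfl⟩, hm, rfl⟩
    have hz : ∀ w : K × K × K, w ≠ 0 → (∃ s ∈ E, ∃ t ∈ E, s • u + t • v = w) → w.2.2 = 0 := by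
      rintro w hw ⟨s, hs, t, ht, rfl⟩
      refine hm ⟨s, hs, t, ht, hw, rfl⟩ _ ?_
      rw [Projectivization.submodule_mk]
      exact Submodule.mem_span_singleton_self _
    have hu := hz u (huv.ne_zero 0) ⟨1, E.one_mem, 0, E.zero_mem, by simp⟩
    have hv := hz v (huv.ne_zero 1) ⟨0, E.zero_mem, 1, E.one_mem, by simp⟩
    obtain ⟨a, b, c⟩ := u
    obtain ⟨a', b', c'⟩ := v
    obtain rfl : c = 0 := hu
    obtain rfl : c' = 0 := hv
    refine ⟨(a, b), (a', b'), ?_, himage (a, b) (a', b')⟩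
    rw [LinearIndependent.pair_iff] at huv ⊢
    intro s t h
    refine huv s t ?_
    rw [Prod.ext_iff] at h
    simpa using h
  · rintro ⟨u, v, huv, rfl⟩
    refine ⟨_, ⟨(u.1, u.2, 0), (v.1, v.2, 0), ?_, rfl⟩, ?_, himage u v⟩
    · rw [LinearIndependent.pair_iff] at huv ⊢
      intro s t h
      refine huv s t ?_
      rw [Prod.ext_iff]
      simpa using h
    · rintro _ ⟨s, -, t, -, h, rfl⟩ w hw
      rw [Projectivization.submodule_mk, Submodule.mem_span_singleton] at hw
      obtain ⟨r, rfl⟩ := hw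
      simp

/-- The subspace is the `E`-span of `u` and `v`, viewed over `F`. It meets the element through one
of its vectors `w` exactly in the `E`-multiples of `w`. -/
theorem exists_meets_in_subspread [Finite K] (E : IntermediateField F K) {u v : K × K}
    (h : LinearIndependent K ![u, v]) :
    ∃ W : Submodule F (K × K × F), W ≤ hyperplaneInfinity F K ∧
      Module.finrank F W = 2 * Module.finrank F E ∧
      ∀ A ∈ spreadMeeting F (Submodule.span E {u, v}), A ⊓ W ∈ subspread E := by
  refine ⟨((Submodule.span E {u, v}).restrictScalars F).map (inclInfinity F K), ?_, ?_, ?_⟩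
  · rw [← range_inclInfinity]
    exact LinearMap.map_le_range
  · rw [← (Submodule.equivMapOfInjective _ inclInfinity_injective _).finrank_eq, mul_comm,
      ← finrank_span_pair (G := E) h]
    exact (Module.finrank_mul_finrank F E (Submodule.span E {u, v})).symm
  · rintro _ ⟨w, hw, hw0, rfl⟩
    refine ⟨w.1, w.2, hw0, ?_⟩
    ext p
    rw [mem_spreadElement]
    constructor
    · rintro ⟨hp, hpW⟩
      obtain ⟨x, rfl⟩ := mem_spreadThrough.1 hp
      obtain ⟨y, hy, hyx⟩ := hpW
      obtain rfl := inclInfinity_injective hyx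
      refine ⟨x, ?_, rfl⟩
      obtain ⟨s, t, rfl⟩ := Submodule.mem_span_pair.1 hw
      obtain ⟨s', t', e⟩ := Submodule.mem_span_pair.1
        (show x • (s • u + t • v) ∈ Submodule.span E {u, v} from hy)
      have e' : (s' : K) • u + (t' : K) • v = (x * s) • u + (x * t) • v := by
        rw [mul_smul, mul_smul, ← smul_add]
        exact e
      obtain ⟨h1, h2⟩ := smul_add_smul_inj h e'
      -- The multiplier `x` is a quotient of coordinates in `E`, taken at whichever coordinate of
      -- `w` is nonzero.
      by_cases hs : (s : K) = 0
      · have ht : (t : K) ≠ 0 := by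
          intro ht
          apply hw0
          rw [ZeroMemClass.coe_eq_zero.1 hs, ZeroMemClass.coe_eq_zero.1 ht]
          simp
        rw [← mul_div_cancel_right₀ x ht, ← h2]
        exact E.div_mem t'.2 t.2
      · rw [← mul_div_cancel_right₀ x hs, ← h1]
        exact E.div_mem s'.2 s.2
    · rintro ⟨x, hx, rfl⟩
      exact ⟨smul_mem_spreadThrough x w,
        ⟨x • w, (Submodule.span E {u, v}).smul_mem (⟨x, hx⟩ : E) hw, rfl⟩⟩

/-! ### Counting: subspaces with large traces give closure under reguli -/

/-- If `q ^ k + 1` spread elements meet the `2 k`-dimensional space `W` in `k`-dimensional spaces,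
then they cover `W`. -/
theorem exists_mem_of_finrank_inf [Finite F] [Finite K] {k : ℕ}
    {S : Set (Submodule F (K × K × F))} (hS : S ⊆ desarguesianSpread F K)
    (hcard : S.ncard = Nat.card F ^ k + 1) {W : Submodule F (K × K × F)}
    (hW : Module.finrank F W = 2 * k)
    (hSW : ∀ A ∈ S, Module.finrank F (A ⊓ W : Submodule F (K × K × F)) = k)
    {p : K × K × F} (hp : p ∈ W) (hp0 : p ≠ 0) : ∃ A ∈ S, p ∈ A := by
  have hnz : ∀ M : Submodule F (K × K × F),
      Nat.card {x : M // x ≠ 0} = Nat.card F ^ Module.finrank F M - 1 := by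
    intro M
    have : Nat.card {x : M // x ≠ 0} = (({0} : Set M)ᶜ).ncard := (Nat.card_coe_set_eq _)
    rw [this, Set.ncard_compl, Set.ncard_singleton, Module.natCard_eq_pow_finrank (K := F)]
  let f : (Σ A : S, {x : (A.1 ⊓ W : Submodule F (K × K × F)) // x ≠ 0}) → {x : W // x ≠ 0} :=
    fun x => ⟨⟨x.2.1, x.2.1.2.2⟩, fun h => x.2.2 (Subtype.ext (congrArg (fun z : W => (z : K × K × F)) h))⟩
  have hf : Function.Injective f := by
    rintro ⟨⟨A, hA⟩, ⟨⟨x, hx⟩, hx0⟩⟩ ⟨⟨B, hB⟩, ⟨⟨y, hy⟩, hy0⟩⟩ hxy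
    have e : x = y := congrArg (fun z => (z.1.1 : K × K × F)) hxy
    subst e
    obtain ⟨a, -, rfl⟩ := mem_desarguesianSpread.1 (hS hA)
    obtain ⟨b, -, rfl⟩ := mem_desarguesianSpread.1 (hS hB)
    have hne : x ≠ 0 := fun h => hx0 (Subtype.ext h)
    have e := spreadThrough_eq_of_mem hne hx.1 hy.1
    generalize spreadThrough F a = A at *
    subst e
    rfl
  have hfin : Finite S := Set.toFinite S
  have hfs : Fintype S := Fintype.ofFinite S
  have hsurj : Function.Surjective f := by
    refine (hf.bijective_of_nat_card_le ?_).2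
    -- Disjointness made `f` injective; the count `(q^k + 1)(q^k - 1) = q^(2k) - 1` makes it
    -- bijective.
    rw [hnz, hW, Nat.card_sigma, Finset.sum_congr rfl (fun A _ => (hnz _).trans (by rw [hSW A A.2])),
      Finset.sum_const, Finset.card_univ, ← Nat.card_eq_fintype_card, Nat.card_coe_set_eq, hcard,
      smul_eq_mul, ← Nat.sq_sub_sq, mul_comm 2 k, pow_mul, one_pow]
  obtain ⟨⟨⟨A, hA⟩, ⟨⟨x, hx⟩, hx0⟩⟩, hxp⟩ := hsurj ⟨⟨p, hp⟩, fun h => hp0 (congrArg Subtype.val h)⟩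
  have e : x = p := congrArg (fun z => (z.1.1 : K × K × F)) hxp
  exact ⟨A, hA, e ▸ hx.1⟩

/-- `W` is spanned by its traces on two elements of the frame and meets the third, so it meets every
`D` of the regulus. A common point is covered by some member of `S`, and spread elements sharing a
point coincide. -/
theorem subset_of_finrank_inf [Finite F] [Finite K] {k : ℕ} (hk : k ≠ 0)
    {S : Set (Submodule F (K × K × F))} (hS : S ⊆ desarguesianSpread F K)
    (hcard : S.ncard = Nat.card F ^ k + 1) {W : Submodule F (K × K × F)}
    (hW : Module.finrank F W = 2 * k)
    (hSW : ∀ A ∈ S, Module.finrank F (A ⊓ W : Submodule F (K × K × F)) = k)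
    {u v : K × K} (h : LinearIndependent K ![u, v]) (hu : spreadThrough F u ∈ S)
    (hv : spreadThrough F v ∈ S) (huv : spreadThrough F (u + v) ∈ S) :
    spreadMeeting F (Submodule.span F {u, v}) ⊆ S := by
  intro D hD
  have hDW : D ⊓ W ≠ ⊥ := by
    refine meets_of_meets_frame h ?_ ?_ hD
    · rw [hW, hSW _ hu, hSW _ hv, two_mul]
    · intro e
      have := hSW _ huv
      rw [e, finrank_bot] at this
      exact hk this.symm
  obtain ⟨p, ⟨hpD, hpW⟩, hp0⟩ := Submodule.exists_mem_ne_zero_of_ne_bot hDW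
  obtain ⟨A, hA, hpA⟩ := exists_mem_of_finrank_inf hS hcard hW hSW hpW hp0
  obtain ⟨w, -, -, rfl⟩ := hD
  obtain ⟨a, -, rfl⟩ := mem_desarguesianSpread.1 (hS hA)
  rwa [spreadThrough_eq_of_mem hp0 hpD hpA]

/-! ### Sets closed under reguli are sublines -/

/-- Closure of a set of spread elements under reguli, in terms of frames. -/
def IsRegulusClosed (S : Set (Submodule F (K × K × F))) : Prop :=
  ∀ u v : K × K, LinearIndependent K ![u, v] → spreadThrough F u ∈ S → spreadThrough F v ∈ S →
    spreadThrough F (u + v) ∈ S → spreadMeeting F (Submodule.span F {u, v}) ⊆ S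

theorem linearIndependent_add_smul {u v : K × K} (h : LinearIndependent K ![u, v]) (a : K) {b : K}
    (hb : b ≠ 0) : LinearIndependent K ![u + a • v, b • v] := by
  rw [LinearIndependent.pair_iff]
  intro s t hst
  have := LinearIndependent.pair_iff.1 h s (s * a + t * b) (by
    rw [← hst]
    module)
  obtain ⟨rfl, h2⟩ := this
  simp_all

/-- The reguli used are those containing the element through `v`. In the affine coordinate `t` they
are the affine `F`-lines of `K`, so the set of parameters is closed under them and contains 0. -/
theorem IsRegulusClosed.exists_submodule {S : Set (Submodule F (K × K × F))}
    (hF : ∃ c : F, c ≠ 0 ∧ c ≠ 1)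
    (hS : IsRegulusClosed S) {u v : K × K} (h : LinearIndependent K ![u, v])
    (hu : spreadThrough F u ∈ S) (hv : spreadThrough F v ∈ S) :
    ∃ T : Submodule F K, ∀ t, t ∈ T ↔ spreadThrough F (u + t • v) ∈ S := by
  have key : ∀ a b : K, spreadThrough F (u + a • v) ∈ S → spreadThrough F (u + b • v) ∈ S →
      ∀ c : F, spreadThrough F (u + (a + c • (b - a)) • v) ∈ S := by
    intro a b ha hb c
    by_cases hab : b - a = 0
    · simpa [hab] using ha
    -- The frame `u + a v`, `(b - a) v` has sum `u + b v`.
    have hl := linearIndependent_add_smul h a hab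
    refine hS _ _ hl ha ?_ ?_ ((mem_spreadMeeting_span hl).2 (Or.inr ⟨c, ?_⟩))
    · rwa [spreadThrough_smul hab]
    · rwa [add_assoc, ← add_smul, add_sub_cancel]
    · rw [add_smul, add_assoc, smul_assoc]
  have hsmul : ∀ (c : F) (a : K), spreadThrough F (u + a • v) ∈ S →
      spreadThrough F (u + (c • a) • v) ∈ S := by
    intro c a ha
    simpa using key 0 a (by simpa using hu) ha c
  obtain ⟨c, hc0, hc1⟩ := hF
  refine ⟨{ carrier := {t | spreadThrough F (u + t • v) ∈ S}
            add_mem' := ?_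
            zero_mem' := by simpa using hu
            smul_mem' := fun c a ha => hsmul c a ha }, fun t => Iff.rfl⟩
  intro a b ha hb
  -- A scalar `c` other than 0 and 1 writes `a + b` as the affine combination, with weights `1 - c`
  -- and `c`, of `(1 - c)⁻¹ a` and `c⁻¹ b`.
  have h1 : 1 - c ≠ 0 := sub_ne_zero.2 (Ne.symm hc1)
  have := key _ _ (hsmul (1 - c)⁻¹ a ha) (hsmul c⁻¹ b hb) c
  have e : (1 - c)⁻¹ • a + c • (c⁻¹ • b - (1 - c)⁻¹ • a) = a + b := by
    rw [smul_sub, smul_inv_smul₀ hc0, add_sub_left_comm, add_comm]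
    congr 1
    conv_rhs => rw [← smul_inv_smul₀ h1 a]
    rw [sub_smul, one_smul]
  rwa [e] at this

/-- The affine parameters of `S` relative to `(u, v)` and to `(v, u)` form two subspaces exchanged
by inversion, since `u + x v` and `v + x⁻¹ u` are proportional. Hence the first is a subfield, and
`|S|` determines its degree. -/
theorem IsRegulusClosed.eq_spreadMeeting [Finite F] [Finite K] (hq : 2 < Nat.card F)
    (E : IntermediateField F K) {S : Set (Submodule F (K × K × F))}
    (hSD : S ⊆ desarguesianSpread F K)
    (hcard : S.ncard = Nat.card F ^ Module.finrank F E + 1) (hS : IsRegulusClosed S)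
    {u v : K × K} (h : LinearIndependent K ![u, v]) (hu : spreadThrough F u ∈ S)
    (hv : spreadThrough F v ∈ S) (huv : spreadThrough F (u + v) ∈ S) :
    S = spreadMeeting F (Submodule.span E {u, v}) := by
  have hF : ∃ c : F, c ≠ 0 ∧ c ≠ 1 := by
    by_contra! hc
    have : (Set.univ : Set F) ⊆ {0, 1} := by
      intro c _
      by_cases h0 : c = 0
      · simp [h0]
      · simp [hc c h0]
    have h1 := Set.ncard_le_ncard this (Set.toFinite _)
    rw [Set.ncard_univ, Set.ncard_pair zero_ne_one] at h1
    omega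
  have hsymm : LinearIndependent K ![v, u] := LinearIndependent.pair_symm_iff.1 h
  obtain ⟨T, hT⟩ := hS.exists_submodule hF h hu hv
  obtain ⟨T', hT'⟩ := hS.exists_submodule hF hsymm hv hu
  obtain ⟨E', hE'⟩ := exists_intermediateField_of_inv (T := T) (T' := T')
    ((hT 1).2 (by simpa using huv)) (by
      intro x hx
      rw [hT, hT', ← spreadThrough_smul (inv_ne_zero hx) (u + x • v), smul_add,
        inv_smul_smul₀ hx, add_comm])
  have hSE : S = spreadMeeting F (Submodule.span E' {u, v}) := by
    ext A
    rw [mem_spreadMeeting_span h]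
    constructor
    · intro hA
      obtain ⟨w, hw, rfl⟩ := mem_desarguesianSpread.1 (hSD hA)
      -- Over `K` itself, `u` and `v` span everything, so each spread element has an affine
      -- parameter or is the one through `v`.
      have hwm : spreadThrough F w ∈ spreadMeeting F (Submodule.span K {u, v}) := by
        refine ⟨w, ?_, hw, rfl⟩
        have : Submodule.span K {u, v} = ⊤ := by
          refine Submodule.eq_top_of_finrank_eq ?_
          rw [finrank_span_pair h]
          simp
        rw [this]
        trivial
      rcases (mem_spreadMeeting_span h).1 hwm with e | ⟨t, e⟩
      · exact Or.inl e
      · rw [e] at hA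
        exact Or.inr ⟨⟨t, (hE' t).2 ((hT t).2 hA)⟩, e⟩
    · rintro (rfl | ⟨t, rfl⟩)
      · exact hv
      · exact (hT t).1 ((hE' t).1 t.2)
  have hfr : Module.finrank F E = Module.finrank F E' := by
    have h1 := ncard_spreadMeeting_span (F := F) (G := E') h
    rw [← hSE, hcard, Module.natCard_eq_pow_finrank (K := F) (V := E'), add_left_inj] at h1
    exact Nat.pow_right_injective (by omega) h1
  rw [intermediateField_eq_of_finrank_eq hfr]
  exact hSE

theorem exists_eq_spreadMeeting [Finite F] [Finite K] (hq : 2 < Nat.card F)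
    (E : IntermediateField F K) {S : Set (Submodule F (K × K × F))}
    (hSD : S ⊆ desarguesianSpread F K)
    (hcard : S.ncard = Nat.card F ^ Module.finrank F E + 1) (hS : IsRegulusClosed S) :
    ∃ u v : K × K, LinearIndependent K ![u, v] ∧
      S = spreadMeeting F (Submodule.span E {u, v}) := by
  have h2 : 2 < S.ncard := by
    have := Nat.le_self_pow (Module.finrank_pos (R := F) (M := E)).ne' (Nat.card F)
    omega
  obtain ⟨A, hA, B, hB, C, hC, hAB, hAC, hBC⟩ := (Set.two_lt_ncard (Set.toFinite S)).1 h2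
  obtain ⟨u, v, h, rfl, rfl, rfl⟩ :=
    exists_frame_spread (hSD hA) (hSD hB) (hSD hC) hAB hAC hBC
  exact ⟨u, v, h, hS.eq_spreadMeeting hq E hSD hcard h hA hB hC⟩

/-- Condition 2 and closure in frames agree because every triple has a frame, every frame gives
three distinct elements, and the regulus through them is the `F`-subline of the frame. -/
theorem isRegulusClosed_iff [Finite F] [Finite K] {S : Set (Submodule F (K × K × F))}
    (hS : S ⊆ desarguesianSpread F K) :
    IsRegulusClosed S ↔ ∀ A ∈ S, ∀ B ∈ S, ∀ C ∈ S, A ≠ B → A ≠ C → B ≠ C →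
      ∀ R, IsRegulusThrough F (Module.finrank F K) A B C R → R ⊆ S := by
  constructor
  · intro h A hA B hB C hC hAB hAC hBC R hR
    obtain ⟨u, v, huv, rfl, rfl, rfl⟩ := exists_frame_spread (hS hA) (hS hB) (hS hC) hAB hAC hBC
    rw [(isRegulusThrough_iff huv).1 hR]
    exact h u v huv hA hB hC
  · intro h u v huv hu hv hw
    refine h _ hu _ hv _ hw ?_ ?_ ?_ _ ((isRegulusThrough_iff huv).2 rfl)
    · simpa using spreadThrough_add_smul_ne (F := F) huv 0
    · intro e
      have := spreadThrough_add_smul_inj (F := F) huv (s := 0) (t := 1) (by simpa using e)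
      simp at this
    · simpa using (spreadThrough_add_smul_ne (F := F) huv 1).symm

theorem existsUnique_isRegulusThrough [Finite F] [Finite K] {A B C : Submodule F (K × K × F)}
    (hA : A ∈ desarguesianSpread F K) (hB : B ∈ desarguesianSpread F K)
    (hC : C ∈ desarguesianSpread F K) (hAB : A ≠ B) (hAC : A ≠ C) (hBC : B ≠ C) :
    ∃! R, IsRegulusThrough F (Module.finrank F K) A B C R := by
  obtain ⟨u, v, huv, rfl, rfl, rfl⟩ := exists_frame_spread hA hB hC hAB hAC hBC
  exact ⟨_, (isRegulusThrough_iff huv).2 rfl, fun R hR => (isRegulusThrough_iff huv).1 hR⟩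

theorem finrank_of_mem_subspread {E : IntermediateField F K} {A : Submodule F (K × K × F)}
    (hA : A ∈ subspread E) : Module.finrank F A = Module.finrank F E := by
  obtain ⟨a, b, hab, rfl⟩ := hA
  exact finrank_spreadElement E (w := (a, b)) hab

end ABB
theorem theorem2p10 {F K : Type*} [Field F] [Finite F] [Field K] [Finite K] [Algebra F K]
    (q n k : ℕ) (hq : Nat.card F = q) (hq2 : 2 < q) (hn : Module.finrank F K = n)
    (E : IntermediateField F K) (hE : Module.finrank F E = k)
    (S : Set (Submodule F (K × K × F))) (hS : S ⊆ ABB.desarguesianSpread F K)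
    (hcard : S.ncard = q ^ k + 1) :
    -- any three elements of the spread lie in a unique regulus
    (∀ A ∈ ABB.desarguesianSpread F K, ∀ B ∈ ABB.desarguesianSpread F K,
      ∀ C ∈ ABB.desarguesianSpread F K, A ≠ B → A ≠ C → B ≠ C →
        ∃! R : Set (Submodule F (K × K × F)), ABB.IsRegulusThrough F n A B C R) ∧
    List.TFAE [
      -- (1)
      ∃ m : Set (ℙ K (K × K × K)), ABB.IsSubline E m ∧ m ⊆ ABB.lineInfinity K ∧
        ABB.abbMap F '' m = S,
      -- (2)
      ∀ A ∈ S, ∀ B ∈ S, ∀ C ∈ S, A ≠ B → A ≠ C → B ≠ C →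
        ∀ R : Set (Submodule F (K × K × F)), ABB.IsRegulusThrough F n A B C R → R ⊆ S,
      -- (3)
      ∃ W : Submodule F (K × K × F), W ≤ ABB.hyperplaneInfinity F K ∧
        Module.finrank F W = 2 * k ∧
        ∀ A ∈ S, Module.finrank F (A ⊓ W : Submodule F (K × K × F)) = k,
      -- (4)
      ∃ W : Submodule F (K × K × F), W ≤ ABB.hyperplaneInfinity F K ∧
        Module.finrank F W = 2 * k ∧
        ∀ A ∈ S, A ⊓ W ∈ ABB.subspread E] := by
  subst hq hn hE
  refine ⟨fun A hA B hB C hC => ABB.existsUnique_isRegulusThrough hA hB hC, ?_⟩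
  tfae_have 1 → 4 := by
    intro h
    obtain ⟨u, v, huv, rfl⟩ := (ABB.exists_isSubline_iff E S).1 h
    exact ABB.exists_meets_in_subspread E huv
  tfae_have 4 → 3 := by
    rintro ⟨W, hW, hdim, h⟩
    exact ⟨W, hW, hdim, fun A hA => ABB.finrank_of_mem_subspread (h A hA)⟩
  tfae_have 3 → 2 := by
    rintro ⟨W, -, hdim, h⟩
    rw [← ABB.isRegulusClosed_iff hS]
    intro u v huv hu hv hw
    exact ABB.subset_of_finrank_inf Module.finrank_pos.ne' hS hcard hdim h huv hu hv hw
  tfae_have 2 → 1 := by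
    intro h
    rw [ABB.exists_isSubline_iff]
    exact ABB.exists_eq_spreadMeeting hq2 E hS hcard ((ABB.isRegulusClosed_iff hS).2 h)
  tfae_finish
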